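/- Let $\mathcal H$ be a class of probability distributions on $\mathbb R$ such that $\int x\,H(dx)=0$ and $\int x^2\,H(dx)=1$ for all $H\in\mathcal H$, and $$\lim_{c\to\infty}\ \sup_{H\in\mathcal H}\int_{|x|>c}x^2\,H(dx)=0 .$$ Then for every $\varepsilon>0$ there is a $\delta>0$, depending only on $\varepsilon$ and $\mathcal H$, with the following property. Let $F\in\mathcal H$, let $\xi_{r,s}$ ($r,s\in\mathbb Z$) be independent random variables with common distribution $F$ on a probability space $(\Omega,\mathcal A,P)$, let $\mathbf a=(a_{r,s})_{r,s\in\mathbb Z}$ be a square-summable real array, let $$X_{j,k}=\sum_{r\in\mathbb Z}\sum_{s\in\mathbb Z}a_{r,s}\,\xi_{j-r,k-s}$$ (convergence in $L^2(P)$), and for a finite set $\Gamma\subset\mathbb Z^2$ put $$S=\sum_{(j,k)\in\Gamma}X_{j,k},\qquad \sigma=\sqrt{E(S^2)},\qquad b_{r,s}=\sum_{(j,k)\in\Gamma}a_{j+r,k+s}.$$ If $\sigma>0$ and $$\rho:=\max_{r,s\in\mathbb Z}\frac{|b_{r,s}|}{\sigma}\le\delta,$$ then $$\sup_{z\in\mathbb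 R}|G(z)-\Phi(z)|\le\varepsilon,$$ where $G(z)=P[S/\sigma\le z]$ and $\Phi$ is the standard normal distribution function. -/

import Mathlib

open MeasureTheory ProbabilityTheory Filter Topology

noncomputable section

namespace LinearRandomField

/-- The array `ξ` over `ℤ²` consists of independent random variables, each with law `F`. -/
structure IsIID {Ω : Type*} [MeasurableSpace Ω] (ξ : ℤ × ℤ → Ω → ℝ) (F : Measure ℝ)
    (P : Measure Ω) : Prop where
  indep : iIndepFun ξ P
  law : ∀ i, HasLaw (ξ i) F P

open Classical in
/-- The class in `L²(P)` of a square integrable random variable (and `0` for any other function). -/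
def toL2 {Ω : Type*} [MeasurableSpace Ω] (P : Measure Ω) (f : Ω → ℝ) : Lp ℝ 2 P :=
  if h : MemLp f 2 P then h.toLp f else 0

/-- The linear field `X_j = ∑_r a_r ξ_{j-r}`, `j ∈ ℤ²`, the series being summed in `L²(P)`.
See `hasSum_field` for its convergence. -/
def field {Ω : Type*} [MeasurableSpace Ω] (P : Measure Ω) (ξ : ℤ × ℤ → Ω → ℝ)
    (a : ℤ × ℤ → ℝ) (j : ℤ × ℤ) : Lp ℝ 2 P :=
  ∑' r : ℤ × ℤ, a r • toL2 P (ξ (j - r))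

/-- `S = ∑_{j ∈ Γ} X_j`. -/
def S {Ω : Type*} [MeasurableSpace Ω] (P : Measure Ω) (ξ : ℤ × ℤ → Ω → ℝ)
    (a : ℤ × ℤ → ℝ) (Γ : Finset (ℤ × ℤ)) : Lp ℝ 2 P :=
  ∑ j ∈ Γ, field P ξ a j

/-- `σ = (E S²)^{1/2}`. -/
def sigma {Ω : Type*} [MeasurableSpace Ω] (P : Measure Ω) (ξ : ℤ × ℤ → Ω → ℝ)
    (a : ℤ × ℤ → ℝ) (Γ : Finset (ℤ × ℤ)) : ℝ :=
  Real.sqrt (∫ ω, (S P ξ a Γ ω) ^ 2 ∂P)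

/-- `b_r = ∑_{j ∈ Γ} a_{j+r}`. -/
def b (a : ℤ × ℤ → ℝ) (Γ : Finset (ℤ × ℤ)) (r : ℤ × ℤ) : ℝ :=
  ∑ j ∈ Γ, a (j + r)

/-- `ρ = max_r |b_r| / σ`. -/
def rho {Ω : Type*} [MeasurableSpace Ω] (P : Measure Ω) (ξ : ℤ × ℤ → Ω → ℝ)
    (a : ℤ × ℤ → ℝ) (Γ : Finset (ℤ × ℤ)) : ℝ :=
  ⨆ r : ℤ × ℤ, |b a Γ r| / sigma P ξ a Γ

/-- `G(z) = P[S / σ ≤ z]`. -/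
def G {Ω : Type*} [MeasurableSpace Ω] (P : Measure Ω) (ξ : ℤ × ℤ → Ω → ℝ)
    (a : ℤ × ℤ → ℝ) (Γ : Finset (ℤ × ℤ)) (z : ℝ) : ℝ :=
  P.real {ω | S P ξ a Γ ω / sigma P ξ a Γ ≤ z}

/-- The standard normal distribution function. -/
def Phi (z : ℝ) : ℝ := cdf (gaussianReal 0 1) z

/-- The Kolmogorov distance `sup_z |U(z) - V(z)|` of two distribution functions. -/
def kolmogorovDist (U V : ℝ → ℝ) : ℝ := ⨆ z : ℝ, |U z - V z|

/-- Independent variables with a common law of mean zero and unit variance lie in `L²`. -/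
theorem IsIID.memLp {Ω : Type*} [MeasurableSpace Ω] {ξ : ℤ × ℤ → Ω → ℝ} {F : Measure ℝ}
    {P : Measure Ω} (h : IsIID ξ F P) (hvar : ∫ x, x ^ 2 ∂F = 1) (i : ℤ × ℤ) :
    MemLp (ξ i) 2 P := by
  have hF : MemLp (fun x : ℝ => x) 2 F := by
    rw [memLp_two_iff_integrable_sq (by fun_prop)]
    exact not_imp_comm.1 integral_undef (by rw [hvar]; norm_num)
  rw [← (h.law i).map_eq] at hF
  exact hF.comp_of_map (h.law i).aemeasurable

/-- The innovations are orthonormal in `L²(P)`. -/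
theorem IsIID.orthonormal {Ω : Type*} [MeasurableSpace Ω] {ξ : ℤ × ℤ → Ω → ℝ} {F : Measure ℝ}
    {P : Measure Ω} [IsProbabilityMeasure P] (h : IsIID ξ F P) (hmean : ∫ x, x ∂F = 0)
    (hvar : ∫ x, x ^ 2 ∂F = 1) : Orthonormal ℝ (fun i => toL2 P (ξ i)) := by
  classical
  have hm := h.memLp hvar
  have key : ∀ i j, inner ℝ (toL2 P (ξ i)) (toL2 P (ξ j)) = ∫ ω, ξ i ω * ξ j ω ∂P := by
    intro i j
    rw [L2.inner_def]
    refine integral_congr_ae ?_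
    simp only [toL2, hm, dif_pos]
    filter_upwards [(hm i).coeFn_toLp, (hm j).coeFn_toLp] with ω h1 h2
    rw [h1, h2]
    simp [mul_comm]
  rw [orthonormal_iff_ite]
  intro i j
  rw [key]
  split_ifs with hij
  · subst hij
    rw [← hvar, ← (h.law i).map_eq, integral_map (h.law i).aemeasurable (by fun_prop)]
    simp [pow_two]
  · have := (h.indep.indepFun hij).integral_fun_mul_eq_mul_integral
      (hm i).aestronglyMeasurable (hm j).aestronglyMeasurable
    rw [this]
    have h0 : ∫ ω, ξ i ω ∂P = 0 := by
      rw [← hmean, ← (h.law i).map_eq, integral_map (h.law i).aemeasurable (by fun_prop)]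
    rw [h0, zero_mul]

/-- For square summable coefficients the series defining the field converges in `L²(P)`. -/
theorem hasSum_field {Ω : Type*} [MeasurableSpace Ω] {ξ : ℤ × ℤ → Ω → ℝ} {F : Measure ℝ}
    {P : Measure Ω} [IsProbabilityMeasure P] (h : IsIID ξ F P) (hmean : ∫ x, x ∂F = 0)
    (hvar : ∫ x, x ^ 2 ∂F = 1) (a : lp (fun _ : ℤ × ℤ => ℝ) 2) (j : ℤ × ℤ) :
    HasSum (fun r => a r • toL2 P (ξ (j - r))) (field P ξ a j) := by
  have ho : Orthonormal ℝ (fun r => toL2 P (ξ (j - r))) :=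
    (h.orthonormal hmean hvar).comp (fun r => j - r) (fun x y hxy => by simpa using hxy)
  have := ho.orthogonalFamily.summable_of_lp a
  simpa [field] using this.hasSum

end LinearRandomField

end

/-!
Interchanging summations, `S = ∑ i, b (-i) • ξ i` in `L²(P)`, so that `S / σ = ∑ i, c i • ξ i` with
coefficients satisfying `∑ i, c i ^ 2 = 1` and `|c i| ≤ ρ`. This is a Lindeberg situation for an
infinite weighted sum, treated by characteristic functions.

If `F` has mean zero, unit variance and second moment at most `η` outside `[-K, K]`, a Taylor
expansion gives `|φ_F(u) - exp (-u² / 2)| ≤ u² (|u| (4 K + 1) + 4 η)` for `|u| ≤ 1`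
(`norm_charFun_sub_exp_le`). The characteristic function of a finite partial sum of `S / σ` at `t`
is the product of the numbers `φ_F(c i * t)`. Comparing it factor by factor with the product of the
`exp (-(c i * t)² / 2)` and passing to the limit in `L²`, one finds that the characteristic
function of `S / σ` differs from `exp (-t² / 2)` by at most `t² (|t| ρ (4 K + 1) + 4 η)`
(`LinearRandomField.IsIID.norm_charFun_map_sub_exp_le`). Uniform integrability makes `η` small by a
choice of `K` that works for the whole class, and then `ρ ≤ δ` makes the other term small,
uniformly for `t` in a bounded interval.

It remains to pass from characteristic functions to distribution functions, uniformly over all laws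
(`exists_charFun_close_imp_cdf_close`): a sequence of laws violating this would have
characteristic functions converging to the normal one, hence would converge weakly by Lévy's
theorem, and its distribution functions would converge uniformly by Pólya's theorem.
-/

/-! ### Characteristic functions near the origin -/

/-- The minimum of a quadratic and a cubic bound: the cubic one is used for small values of a
variable, the quadratic one, which asks only for a second moment, for large values. -/
theorem norm_cexp_mul_I_sub_taylor_le (y : ℝ) :
    ‖Complex.exp (y * Complex.I) - (1 + y * Complex.I - (y : ℂ) ^ 2 / 2)‖
      ≤ 4 * min (y ^ 2) (|y| ^ 3) := by
  have h0 : (0 : ℝ) ≤ |y| := abs_nonneg y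
  have hn : ‖(y : ℂ) * Complex.I‖ = |y| := by simp
  have hsq : y ^ 2 = |y| ^ 2 := (sq_abs y).symm
  rcases le_total |y| 1 with hy | hy
  · have h := Complex.exp_bound (x := y * Complex.I) (by rw [hn]; exact hy) (n := 3) (by norm_num)
    rw [hn] at h
    have e : ∑ m ∈ Finset.range 3, ((y : ℂ) * Complex.I) ^ m / (m.factorial : ℂ)
        = 1 + y * Complex.I - (y : ℂ) ^ 2 / 2 := by
      simp [Finset.sum_range_succ, mul_pow, Nat.factorial]
      ring
    rw [e] at h
    have h3 : |y| ^ 3 ≤ |y| ^ 2 := pow_le_pow_of_le_one h0 hy (by norm_num)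
    rw [hsq, min_eq_right h3]
    refine h.trans ?_
    norm_num [Nat.factorial]
    nlinarith [pow_nonneg h0 3]
  · have h3 : |y| ^ 2 ≤ |y| ^ 3 := pow_le_pow_right₀ hy (by norm_num)
    rw [hsq, min_eq_left h3]
    have h1 : ‖Complex.exp (y * Complex.I)‖ = 1 := Complex.norm_exp_ofReal_mul_I y
    have h2 : ‖(1 : ℂ) + y * Complex.I - (y : ℂ) ^ 2 / 2‖ ≤ 1 + |y| + |y| ^ 2 / 2 := by
      refine (norm_sub_le _ _).trans (add_le_add ((norm_add_le _ _).trans ?_) ?_)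
      · simp
      · simp
    refine (norm_sub_le _ _).trans ?_
    nlinarith

/-- Splitting the second moment at `|x| = c` controls the error of the quadratic approximation of
the characteristic function by the tail of the second moment alone; no third moment is needed. -/
theorem norm_charFun_sub_quadratic_le {F : Measure ℝ} [IsProbabilityMeasure F]
    (hmean : ∫ x, x ∂F = 0) (hvar : ∫ x, x ^ 2 ∂F = 1) {c η : ℝ} (hc : 0 ≤ c) (hη : 0 ≤ η)
    (htail : ∫⁻ x in {x : ℝ | c < |x|}, ENNReal.ofReal (x ^ 2) ∂F ≤ ENNReal.ofReal η) (u : ℝ) :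
    ‖charFun F u - (1 - (u : ℂ) ^ 2 / 2)‖ ≤ u ^ 2 * (4 * (|u| * c + η)) := by
  have hsq : Integrable (fun x : ℝ => x ^ 2) F := .of_integral_ne_zero (by rw [hvar]; norm_num)
  have hid : Integrable (fun x : ℝ => x) F :=
    ((memLp_two_iff_integrable_sq (by fun_prop)).2 hsq).integrable one_le_two
  have hsqC : Integrable (fun x : ℝ => (x : ℂ) ^ 2) F := by exact_mod_cast hsq.ofReal (𝕜 := ℂ)
  have hidC : Integrable (fun x : ℝ => (x : ℂ)) F := hid.ofReal
  have hm : MeasurableSet {x : ℝ | c < |x|} := measurableSet_lt measurable_const (by fun_prop)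
  have hexp : Integrable (fun x : ℝ => Complex.exp ((u * x : ℝ) * Complex.I)) F := by
    refine .of_bound (by fun_prop) 1 (.of_forall fun x => ?_)
    rw [Complex.norm_exp_ofReal_mul_I]
  have hexpand : (fun x : ℝ =>
      (1 + (u * x : ℝ) * Complex.I - ((u * x : ℝ) : ℂ) ^ 2 / 2 : ℂ)) =
      fun x : ℝ => 1 + (u * Complex.I) * (x : ℂ) - (u ^ 2 / 2 : ℂ) * (x : ℂ) ^ 2 := by
    ext x; push_cast; ring
  have hquad : Integrable (fun x : ℝ =>
      (1 + (u * x : ℝ) * Complex.I - ((u * x : ℝ) : ℂ) ^ 2 / 2 : ℂ)) F := by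
    rw [hexpand]
    exact ((integrable_const _).add (hidC.const_mul _)).sub (hsqC.const_mul _)
  have hquadInt : ∫ x : ℝ, (1 + (u * x : ℝ) * Complex.I - ((u * x : ℝ) : ℂ) ^ 2 / 2 : ℂ) ∂F
      = 1 - (u : ℂ) ^ 2 / 2 := by
    have hlin : Integrable (fun x : ℝ => 1 + (u * Complex.I) * (x : ℂ)) F :=
      (integrable_const _).add (hidC.const_mul _)
    have h2 : ∫ x : ℝ, (x : ℂ) ^ 2 ∂F = 1 := by
      simp_rw [← Complex.ofReal_pow]
      rw [integral_complex_ofReal, hvar, Complex.ofReal_one]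
    rw [hexpand, integral_sub hlin (hsqC.const_mul _),
      integral_add (integrable_const _) (hidC.const_mul _), integral_const_mul, integral_const_mul,
      integral_complex_ofReal, hmean, h2]
    simp
  have htail' : ∫ x, {x : ℝ | c < |x|}.indicator (fun x => x ^ 2) x ∂F ≤ η := by
    rw [integral_indicator hm, integral_eq_lintegral_of_nonneg_ae
      (.of_forall fun x => sq_nonneg x) (by fun_prop)]
    exact ENNReal.toReal_le_of_le_ofReal hη htail
  have hbound : Integrable (fun x : ℝ => (4 * (u ^ 2 * (|u| * c))) * x ^ 2 +
      (4 * u ^ 2) * {x : ℝ | c < |x|}.indicator (fun x => x ^ 2) x) F :=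
    (hsq.const_mul _).add ((hsq.indicator hm).const_mul _)
  have e : charFun F u - (1 - (u : ℂ) ^ 2 / 2) = ∫ x : ℝ, (Complex.exp ((u * x : ℝ) * Complex.I) -
      (1 + (u * x : ℝ) * Complex.I - ((u * x : ℝ) : ℂ) ^ 2 / 2)) ∂F := by
    rw [integral_sub hexp hquad, hquadInt, charFun_apply_real]
    push_cast
    rfl
  rw [e]
  refine (norm_integral_le_of_norm_le hbound (.of_forall fun x => ?_)).trans ?_
  · refine (norm_cexp_mul_I_sub_taylor_le _).trans ?_
    by_cases hx : c < |x|
    · have : x ∈ {x : ℝ | c < |x|} := hx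
      rw [Set.indicator_of_mem this]
      have h1 := min_le_left ((u * x) ^ 2) (|u * x| ^ 3)
      have h2 : 0 ≤ (4 * (u ^ 2 * (|u| * c))) * x ^ 2 := by positivity
      nlinarith
    · have : x ∉ {x : ℝ | c < |x|} := hx
      rw [Set.indicator_of_notMem this]
      have h1 := min_le_right ((u * x) ^ 2) (|u * x| ^ 3)
      have h2 : |u * x| ^ 3 = u ^ 2 * |u| * x ^ 2 * |x| := by
        rw [abs_mul, ← sq_abs u, ← sq_abs x]; ring
      have h3 : u ^ 2 * |u| * x ^ 2 * |x| ≤ u ^ 2 * |u| * x ^ 2 * c :=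
        mul_le_mul_of_nonneg_left (not_lt.1 hx) (by positivity)
      linarith
  · rw [integral_add (hsq.const_mul _) ((hsq.indicator hm).const_mul _), integral_const_mul,
      integral_const_mul, hvar]
    have := mul_le_mul_of_nonneg_left htail' (by positivity : 0 ≤ 4 * u ^ 2)
    linarith

/-- Comparison with the characteristic function `exp (-u² / 2)` of the standard normal law. -/
theorem norm_charFun_sub_exp_le {F : Measure ℝ} [IsProbabilityMeasure F]
    (hmean : ∫ x, x ∂F = 0) (hvar : ∫ x, x ^ 2 ∂F = 1) {c η : ℝ} (hc : 0 ≤ c) (hη : 0 ≤ η)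
    (htail : ∫⁻ x in {x : ℝ | c < |x|}, ENNReal.ofReal (x ^ 2) ∂F ≤ ENNReal.ofReal η)
    {u : ℝ} (hu : |u| ≤ 1) :
    ‖charFun F u - (Real.exp (-(u ^ 2 / 2)) : ℂ)‖ ≤ u ^ 2 * (|u| * (4 * c + 1) + 4 * η) := by
  have h1 := norm_charFun_sub_quadratic_le hmean hvar hc hη htail u
  have hu2 : u ^ 2 ≤ |u| := by rw [← sq_abs]; nlinarith [abs_nonneg u]
  have h2 : ‖(Real.exp (-(u ^ 2 / 2)) : ℂ) - (1 - (u : ℂ) ^ 2 / 2)‖ ≤ u ^ 2 * |u| := by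
    have h := Real.norm_exp_sub_one_sub_id_le (x := -(u ^ 2 / 2)) (by
      rw [norm_neg, Real.norm_of_nonneg (by positivity)]; linarith)
    have e : (Real.exp (-(u ^ 2 / 2)) : ℂ) - (1 - (u : ℂ) ^ 2 / 2)
        = ((Real.exp (-(u ^ 2 / 2)) - 1 - -(u ^ 2 / 2) : ℝ) : ℂ) := by push_cast; ring
    rw [e, Complex.norm_real]
    refine h.trans ?_
    rw [norm_neg, Real.norm_of_nonneg (by positivity)]
    nlinarith [sq_nonneg u, abs_nonneg u]
  have := norm_sub_le_norm_sub_add_norm_sub (charFun F u) (1 - (u : ℂ) ^ 2 / 2)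
    (Real.exp (-(u ^ 2 / 2)) : ℂ)
  rw [norm_sub_rev (1 - (u : ℂ) ^ 2 / 2)] at this
  linarith

theorem norm_prod_sub_prod_le {ι : Type*} (s : Finset ι) {f g : ι → ℂ}
    (hf : ∀ i, ‖f i‖ ≤ 1) (hg : ∀ i, ‖g i‖ ≤ 1) :
    ‖∏ i ∈ s, f i - ∏ i ∈ s, g i‖ ≤ ∑ i ∈ s, ‖f i - g i‖ := by
  classical
  induction s using Finset.induction_on with
  | empty => simp
  | insert i s hi ih =>
    rw [Finset.prod_insert hi, Finset.prod_insert hi, Finset.sum_insert hi]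
    have e : f i * ∏ j ∈ s, f j - g i * ∏ j ∈ s, g j
        = (f i - g i) * ∏ j ∈ s, f j + g i * (∏ j ∈ s, f j - ∏ j ∈ s, g j) := by ring
    have h1 : ‖∏ j ∈ s, f j‖ ≤ 1 := by
      rw [norm_prod]; exact Finset.prod_le_one (fun _ _ => norm_nonneg _) fun j _ => hf j
    rw [e]
    refine (norm_add_le _ _).trans ?_
    rw [norm_mul, norm_mul]
    exact add_le_add (mul_le_of_le_one_right (norm_nonneg _) h1)
      ((mul_le_of_le_one_left (norm_nonneg _) (hg i)).trans ih)

/-! ### Kolmogorov distance and characteristic functions -/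

/-- **Pólya's theorem**: monotone functions with values in `[0, 1]` which converge pointwise to a
continuous distribution function converge uniformly. -/
theorem eventually_forall_abs_sub_le_of_monotone {ι : Type*} {l : Filter ι} {f : ι → ℝ → ℝ}
    {g : ℝ → ℝ} (hf : ∀ n, Monotone (f n)) (hf0 : ∀ n z, 0 ≤ f n z) (hf1 : ∀ n z, f n z ≤ 1)
    (hg : Monotone g) (hgc : Continuous g) (hbot : Tendsto g atBot (𝓝 0))
    (htop : Tendsto g atTop (𝓝 1)) (h : ∀ z, Tendsto (fun n => f n z) l (𝓝 (g z)))
    {ε : ℝ} (hε : 0 < ε) : ∀ᶠ n in l, ∀ z, |f n z - g z| ≤ ε := by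
  obtain ⟨m, hm⟩ := exists_nat_gt (3 / ε)
  have hm0 : (0 : ℝ) < m := (by positivity : 0 < 3 / ε).trans hm
  have hmε : 3 * (1 / m : ℝ) ≤ ε := by
    rw [div_lt_iff₀ hε] at hm
    rw [mul_one_div, div_le_iff₀ hm0]; linarith
  have hd : (0 : ℝ) < 1 / m := by positivity
  -- quantiles `q k` of order `k / m`, for `0 < k < m`
  have hq : ∀ k : ℕ, ∃ q, 0 < k → k < m → g q = k / m := by
    intro k
    by_cases hk : 0 < k ∧ k < m
    · have h0 : (0 : ℝ) < k / m := div_pos (by exact_mod_cast hk.1) hm0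
      have h1 : (k / m : ℝ) < 1 := by rw [div_lt_one hm0]; exact_mod_cast hk.2
      obtain ⟨x, hx⟩ := (hbot.eventually_lt_const h0).exists
      obtain ⟨y, hy⟩ := (htop.eventually_const_lt h1).exists
      obtain ⟨q, hq⟩ := mem_range_of_exists_le_of_exists_ge hgc ⟨x, hx.le⟩ ⟨y, hy.le⟩
      exact ⟨q, fun _ _ => hq⟩
    · exact ⟨0, fun a b => absurd ⟨a, b⟩ hk⟩
  choose q hq using hq
  have hev : ∀ᶠ n in l, ∀ k ∈ Finset.range m, |f n (q k) - g (q k)| < 1 / m := by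
    rw [Filter.eventually_all_finset]
    intro k _
    simpa [Real.dist_eq] using Metric.tendsto_nhds.1 (h (q k)) (1 / m) hd
  filter_upwards [hev] with n hn z
  have hg0 : 0 ≤ g z := hg.le_of_tendsto hbot z
  have hg1 : g z ≤ 1 := hg.ge_of_tendsto htop z
  obtain ⟨k, hk⟩ : ∃ k : ℕ, k = ⌊m * g z⌋₊ := ⟨_, rfl⟩
  have hk1 : (k : ℝ) / m ≤ g z := by
    rw [div_le_iff₀ hm0, hk, mul_comm]; exact Nat.floor_le (by positivity)
  have hk2 : g z < (k : ℝ) / m + 1 / m := by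
    rw [← add_div, lt_div_iff₀ hm0, hk, mul_comm]; exact Nat.lt_floor_add_one _
  have hkm : k ≤ m := by
    have : (k : ℝ) / m ≤ 1 := hk1.trans hg1
    rw [div_le_one hm0] at this; exact_mod_cast this
  rw [abs_le]
  constructor
  -- the quantile of order `(k - 1) / m`, unlike that of order `k / m`, lies strictly below `z`
  · by_cases hk3 : 2 ≤ k
    · have e := hq (k - 1) (by omega) (by omega)
      have hc : ((k - 1 : ℕ) : ℝ) / m = k / m - 1 / m := by
        rw [Nat.cast_sub (by omega)]; push_cast; ring
      have hlt : q (k - 1) < z := hg.reflect_lt (by rw [e, hc]; linarith)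
      have h1 := hf n hlt.le
      have h2 := (abs_lt.1 (hn (k - 1) (Finset.mem_range.2 (by omega)))).1
      rw [e, hc] at h2
      linarith
    · have : (k : ℝ) / m ≤ 1 / m := by
        gcongr; exact_mod_cast (by omega : k ≤ 1)
      linarith [hf0 n z]
  · by_cases hk3 : k + 1 < m
    · have e := hq (k + 1) (by omega) hk3
      have hc : ((k + 1 : ℕ) : ℝ) / m = k / m + 1 / m := by push_cast; ring
      have hlt : z < q (k + 1) := hg.reflect_lt (by rw [e, hc]; linarith)
      have h1 := hf n hlt.le
      have h2 := (abs_lt.1 (hn (k + 1) (Finset.mem_range.2 hk3))).2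
      rw [e, hc] at h2
      linarith
    · have : (1 : ℝ) ≤ k / m + 1 / m := by
        rw [← add_div, le_div_iff₀ hm0, one_mul]; exact_mod_cast (by omega : m ≤ k + 1)
      linarith [hf1 n z]

theorem continuous_cdf (μ : Measure ℝ) [IsProbabilityMeasure μ] [NullSingletonClass μ] :
    Continuous (cdf μ) := by
  rw [continuous_iff_continuousAt]
  intro x
  rw [(cdf μ).mono.continuousAt_iff_leftLim_eq_rightLim, (cdf μ).rightLim_eq]
  have h := (cdf μ).measure_singleton x
  rw [measure_cdf, measure_singleton, eq_comm, ENNReal.ofReal_eq_zero] at h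
  exact le_antisymm ((cdf μ).mono.leftLim_le le_rfl) (by linarith)

theorem tendsto_cdf_of_tendsto {ι : Type*} {l : Filter ι} {ν : ι → ProbabilityMeasure ℝ}
    {μ : ProbabilityMeasure ℝ} [NullSingletonClass (μ : Measure ℝ)] (h : Tendsto ν l (𝓝 μ))
    (z : ℝ) : Tendsto (fun n => cdf (ν n : Measure ℝ) z) l (𝓝 (cdf (μ : Measure ℝ) z)) := by
  have h1 := ProbabilityMeasure.tendsto_measure_of_null_frontier_of_tendsto' h (E := Set.Iic z)
    (by rw [frontier_Iic]; exact measure_singleton z)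
  simp_rw [cdf_eq_real]
  exact (ENNReal.tendsto_toReal (measure_ne_top _ _)).comp h1

/-- Uniform closeness of characteristic functions on a large interval forces closeness in
Kolmogorov distance to a given atomless law. The bounds are obtained from Lévy's convergence
theorem by contradiction, so they are not explicit. -/
theorem exists_charFun_close_imp_cdf_close (μ : ProbabilityMeasure ℝ)
    [NullSingletonClass (μ : Measure ℝ)] {ε : ℝ} (hε : 0 < ε) :
    ∃ T : ℝ, 0 < T ∧ ∃ η : ℝ, 0 < η ∧ ∀ ν : ProbabilityMeasure ℝ,
      (∀ t, |t| ≤ T → ‖charFun (ν : Measure ℝ) t - charFun (μ : Measure ℝ) t‖ ≤ η) →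
      ∀ z, |cdf (ν : Measure ℝ) z - cdf (μ : Measure ℝ) z| ≤ ε := by
  by_contra! H
  have H' (n : ℕ) := H (n + 1) (by positivity) (1 / ((n : ℝ) + 1)) (by positivity)
  choose ν hν z hz using H'
  have hlim : Tendsto ν atTop (𝓝 μ) := by
    refine ProbabilityMeasure.tendsto_iff_tendsto_charFun.2 fun t => ?_
    rw [tendsto_iff_norm_sub_tendsto_zero]
    refine squeeze_zero' (.of_forall fun _ => norm_nonneg _) ?_
      tendsto_one_div_add_atTop_nhds_zero_nat
    obtain ⟨N, hN⟩ := exists_nat_ge |t|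
    filter_upwards [eventually_ge_atTop N] with n hn
    have : (N : ℝ) ≤ n := by exact_mod_cast hn
    exact hν n t (by linarith)
  obtain ⟨n, hn⟩ := (eventually_forall_abs_sub_le_of_monotone
    (fun n => monotone_cdf (ν n : Measure ℝ)) (fun n => cdf_nonneg _) (fun n => cdf_le_one _)
    (monotone_cdf _) (continuous_cdf _)
    (tendsto_cdf_atBot _) (tendsto_cdf_atTop _) (tendsto_cdf_of_tendsto hlim) hε).exists
  exact (hz n).not_ge (hn (z n))

/-! ### Weighted sums of independent variables -/

/-- **Parseval's identity** for a convergent series in an orthonormal family. -/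
theorem Orthonormal.hasSum_sq_of_hasSum_smul {ι E : Type*} [NormedAddCommGroup E]
    [InnerProductSpace ℝ E] {e : ι → E} (he : Orthonormal ℝ e) {c : ι → ℝ} {x : E}
    (hx : HasSum (fun i => c i • e i) x) : HasSum (fun i => c i ^ 2) (‖x‖ ^ 2) := by
  have h : Tendsto (fun s : Finset ι => ‖∑ i ∈ s, c i • e i‖ ^ 2) atTop (𝓝 (‖x‖ ^ 2)) :=
    (Tendsto.norm hx).pow 2
  refine h.congr fun s => ?_
  rw [← real_inner_self_eq_norm_sq, he.inner_sum]
  simp [pow_two]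

theorem tendsto_charFun_map_of_tendsto_Lp {Ω ι : Type*} [MeasurableSpace Ω] {P : Measure Ω}
    [IsProbabilityMeasure P] {l : Filter ι} [l.IsCountablyGenerated] [l.NeBot]
    {f : ι → Lp ℝ 2 P} {g : Lp ℝ 2 P} (h : Tendsto f l (𝓝 g)) (t : ℝ) :
    Tendsto (fun n => charFun (P.map (f n)) t) l (𝓝 (charFun (P.map g) t)) := by
  have h1 := ((tendstoInMeasure_of_tendsto_Lp h).tendstoInDistribution
    fun n => (Lp.aestronglyMeasurable (f n)).aemeasurable).tendsto
  have h2 := (ProbabilityMeasure.tendsto_iff_forall_integral_rclike_tendsto ℂ).1 h1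
  simp_rw [charFun_eq_integral_innerProbChar]
  exact h2 (BoundedContinuousFunction.innerProbChar t)

namespace LinearRandomField

variable {Ω : Type*} [MeasurableSpace Ω] {P : Measure Ω} {ξ : ℤ × ℤ → Ω → ℝ} {F : Measure ℝ}

theorem IsIID.charFun_map_sum_smul [IsProbabilityMeasure P] (h : IsIID ξ F P)
    (hvar : ∫ x, x ^ 2 ∂F = 1) (c : ℤ × ℤ → ℝ) (s : Finset (ℤ × ℤ)) (t : ℝ) :
    charFun (P.map (∑ i ∈ s, c i • toL2 P (ξ i) : Lp ℝ 2 P)) t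
      = ∏ i ∈ s, charFun F (c i * t) := by
  have hm (i) := (h.law i).aemeasurable
  have hae : (∑ i ∈ s, c i • toL2 P (ξ i) : Lp ℝ 2 P) =ᵐ[P] ∑ i ∈ s, fun ω => c i * ξ i ω := by
    refine (Lp.coeFn_finsetSum _ _).trans ?_
    have : ∀ᵐ ω ∂P, ∀ i, (c i • toL2 P (ξ i) : Lp ℝ 2 P) ω = c i * ξ i ω := by
      rw [ae_all_iff]
      intro i
      have hi : toL2 P (ξ i) = (h.memLp hvar i).toLp := by simp [toL2, h.memLp hvar i]
      rw [hi]
      filter_upwards [Lp.coeFn_smul (c i) (h.memLp hvar i).toLp, (h.memLp hvar i).coeFn_toLp]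
        with ω h1 h2
      simp [h1, h2]
    filter_upwards [this] with ω hω
    simp [Finset.sum_apply, hω]
  have hind : iIndepFun (fun i ω => c i * ξ i ω) P :=
    h.indep.comp (fun i x => c i * x) (fun i => by fun_prop)
  rw [Measure.map_congr hae, iIndepFun.charFun_map_finsetSum_eq_prod
    (fun i _ => (hm i).const_mul _) (hind.restrict s), Finset.prod_apply]
  refine Finset.prod_congr rfl fun i _ => ?_
  rw [charFun_map_mul_comp (hm i), (h.law i).map_eq]

/-- A normalized square summable combination of the innovations with uniformly small coefficients
has almost the characteristic function of the standard normal law. -/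
theorem IsIID.norm_charFun_map_sub_exp_le [IsProbabilityMeasure F] [IsProbabilityMeasure P]
    (h : IsIID ξ F P) (hmean : ∫ x, x ∂F = 0) (hvar : ∫ x, x ^ 2 ∂F = 1) {K η : ℝ}
    (hK : 0 ≤ K) (hη : 0 ≤ η)
    (htail : ∫⁻ x in {x : ℝ | K < |x|}, ENNReal.ofReal (x ^ 2) ∂F ≤ ENNReal.ofReal η)
    {c : ℤ × ℤ → ℝ} {X : Lp ℝ 2 P} (hX : HasSum (fun i => c i • toL2 P (ξ i)) X)
    (hX1 : ‖X‖ = 1) {δ : ℝ} (hc : ∀ i, |c i| ≤ δ) {t : ℝ} (ht : |t| * δ ≤ 1) :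
    ‖charFun (P.map X) t - (Real.exp (-(t ^ 2 / 2)) : ℂ)‖
      ≤ t ^ 2 * (|t| * δ * (4 * K + 1) + 4 * η) := by
  have hsq : HasSum (fun i => c i ^ 2) 1 := by
    have := (h.orthonormal hmean hvar).hasSum_sq_of_hasSum_smul hX
    rwa [hX1, one_pow] at this
  have hcf := tendsto_charFun_map_of_tendsto_Lp (f := fun s => ∑ i ∈ s, c i • toL2 P (ξ i)) hX t
  have hgauss : Tendsto (fun s : Finset (ℤ × ℤ) =>
      ∏ i ∈ s, (Real.exp (-((c i * t) ^ 2 / 2)) : ℂ)) atTop (𝓝 (Real.exp (-(t ^ 2 / 2)) : ℂ)) := by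
    have h1 : Tendsto (fun s : Finset (ℤ × ℤ) => ∑ i ∈ s, c i ^ 2) atTop (𝓝 1) := hsq
    have h2 := (h1.mul_const (-(t ^ 2 / 2)))
    rw [one_mul] at h2
    refine (((Complex.continuous_ofReal.comp Real.continuous_exp).tendsto _).comp h2).congr
      fun s => ?_
    rw [Function.comp_apply, Function.comp_apply, Finset.sum_mul, Real.exp_sum, Complex.ofReal_prod]
    refine Finset.prod_congr rfl fun i _ => ?_
    congr 2; ring
  refine le_of_tendsto (hcf.sub hgauss).norm (.of_forall fun s => ?_)
  have hδ : 0 ≤ δ := (abs_nonneg _).trans (hc 0)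
  have hu (i) : |c i * t| ≤ |t| * δ := by
    rw [abs_mul, mul_comm]; exact mul_le_mul_of_nonneg_left (hc i) (abs_nonneg _)
  rw [h.charFun_map_sum_smul hvar]
  -- the individual errors carry the factors `c i ^ 2`, whose sum is at most `1`
  calc _ ≤ ∑ i ∈ s, ‖charFun F (c i * t) - (Real.exp (-((c i * t) ^ 2 / 2)) : ℂ)‖ := by
        refine norm_prod_sub_prod_le s (fun i => norm_charFun_le_one _) fun i => ?_
        rw [Complex.norm_real, Real.norm_of_nonneg (Real.exp_nonneg _), Real.exp_le_one_iff]
        exact neg_nonpos.2 (by positivity)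
    _ ≤ ∑ i ∈ s, c i ^ 2 * (t ^ 2 * (|t| * δ * (4 * K + 1) + 4 * η)) := by
        refine Finset.sum_le_sum fun i _ => ?_
        refine (norm_charFun_sub_exp_le hmean hvar hK hη htail ((hu i).trans ht)).trans ?_
        rw [mul_pow, mul_assoc]
        gcongr
        exact hu i
    _ = (∑ i ∈ s, c i ^ 2) * (t ^ 2 * (|t| * δ * (4 * K + 1) + 4 * η)) := (Finset.sum_mul ..).symm
    _ ≤ _ := mul_le_of_le_one_left (by positivity)
        (sum_le_hasSum s (fun i _ => sq_nonneg _) hsq)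

/-! ### The normalized sum over `Γ` -/

/-- Interchanging the sums over `Γ` and over `ℤ²` gives `S = ∑_i b_{-i} ξ_i`. -/
theorem hasSum_S [IsProbabilityMeasure P] (h : IsIID ξ F P) (hmean : ∫ x, x ∂F = 0)
    (hvar : ∫ x, x ^ 2 ∂F = 1) (a : lp (fun _ : ℤ × ℤ => ℝ) 2) (Γ : Finset (ℤ × ℤ)) :
    HasSum (fun i => b a Γ (-i) • toL2 P (ξ i)) (S P ξ a Γ) := by
  have hj (j : ℤ × ℤ) : HasSum (fun i => a (j + -i) • toL2 P (ξ i)) (field P ξ a j) := by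
    have := (Equiv.subLeft j).hasSum_iff.2 (hasSum_field h hmean hvar a j)
    simpa [Function.comp_def, sub_eq_add_neg] using this
  have := hasSum_sum (s := Γ) fun j _ => hj j
  simpa only [b, S, Finset.sum_smul] using this

theorem sigma_eq_norm [IsProbabilityMeasure P] (a : ℤ × ℤ → ℝ) (Γ : Finset (ℤ × ℤ)) :
    sigma P ξ a Γ = ‖S P ξ a Γ‖ := by
  rw [sigma, ← Real.sqrt_sq (norm_nonneg (S P ξ a Γ)), ← real_inner_self_eq_norm_sq, L2.inner_def]
  simp [pow_two]

/-- The coefficients satisfy `|b_r| ≤ |Γ| ‖a‖`, so the real supremum defining `ρ` is that of a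
bounded family and does bound every term. -/
theorem abs_b_div_sigma_le_rho (a : lp (fun _ : ℤ × ℤ => ℝ) 2) (Γ : Finset (ℤ × ℤ))
    (r : ℤ × ℤ) : |b a Γ r| / sigma P ξ a Γ ≤ rho P ξ a Γ := by
  refine le_ciSup (f := fun r => |b a Γ r| / sigma P ξ a Γ)
    ⟨(∑ _j ∈ Γ, ‖a‖) / sigma P ξ a Γ, ?_⟩ r
  rintro _ ⟨r, rfl⟩
  refine div_le_div_of_nonneg_right ?_ (Real.sqrt_nonneg _)
  exact (Finset.abs_sum_le_sum_abs _ _).trans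
    (Finset.sum_le_sum fun j _ => lp.norm_apply_le_norm two_ne_zero a (j + r))

theorem G_eq_cdf [IsProbabilityMeasure P] (a : ℤ × ℤ → ℝ) (Γ : Finset (ℤ × ℤ)) (z : ℝ) :
    G P ξ a Γ z = cdf (P.map ((sigma P ξ a Γ)⁻¹ • S P ξ a Γ : Lp ℝ 2 P)) z := by
  have hm := (Lp.aestronglyMeasurable ((sigma P ξ a Γ)⁻¹ • S P ξ a Γ)).aemeasurable
  have := Measure.isProbabilityMeasure_map hm
  rw [cdf_eq_real, map_measureReal_apply_of_aemeasurable hm measurableSet_Iic, G]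
  refine measureReal_congr ?_
  filter_upwards [Lp.coeFn_smul (sigma P ξ a Γ)⁻¹ (S P ξ a Γ)] with ω hω
  change (_ ≤ z) = (_ ≤ z)
  rw [hω, Pi.smul_apply, smul_eq_mul, div_eq_inv_mul]

end LinearRandomField

/-! ### The uniform normal approximation -/

theorem proposition1
    (𝓗 : Set (ProbabilityMeasure ℝ))
    (hmean : ∀ H ∈ 𝓗, ∫ x, x ∂(H : Measure ℝ) = 0)
    (hvar : ∀ H ∈ 𝓗, ∫ x, x ^ 2 ∂(H : Measure ℝ) = 1)
    (hui : Tendsto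
      (fun c : ℝ => ⨆ H ∈ 𝓗, ∫⁻ x in {x : ℝ | c < |x|}, ENNReal.ofReal (x ^ 2) ∂(H : Measure ℝ))
      atTop (𝓝 0)) :
    ∀ ε : ℝ, 0 < ε → ∃ δ : ℝ, 0 < δ ∧
      ∀ F ∈ 𝓗, ∀ (Ω : Type*) [MeasurableSpace Ω] (P : Measure Ω) [IsProbabilityMeasure P]
        (ξ : ℤ × ℤ → Ω → ℝ), LinearRandomField.IsIID ξ (F : Measure ℝ) P →
        ∀ (a : lp (fun _ : ℤ × ℤ => ℝ) 2) (Γ : Finset (ℤ × ℤ)),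
          0 < LinearRandomField.sigma P ξ a Γ →
          LinearRandomField.rho P ξ a Γ ≤ δ →
          LinearRandomField.kolmogorovDist (LinearRandomField.G P ξ a Γ) LinearRandomField.Phi
            ≤ ε := by
  intro ε hε
  let γ : ProbabilityMeasure ℝ := ⟨gaussianReal 0 1, inferInstance⟩
  have : NullSingletonClass (γ : Measure ℝ) := nullSingletonClass_gaussianReal one_ne_zero
  obtain ⟨T, hT, η, hη, hclose⟩ := exists_charFun_close_imp_cdf_close γ hε
  -- the truncation level is chosen first, then `δ` in terms of it
  have hτ : 0 < η / (8 * T ^ 2) := by positivity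
  obtain ⟨K, hK, hK0⟩ := ((hui.eventually_lt_const
    (ENNReal.ofReal_pos.2 hτ)).and (eventually_ge_atTop 0)).exists
  refine ⟨min (1 / T) (η / (2 * T ^ 3 * (4 * K + 1))), by positivity, ?_⟩
  intro F hF Ω _ P _ ξ h a Γ hσ hρ
  have htail : ∫⁻ x in {x : ℝ | K < |x|}, ENNReal.ofReal (x ^ 2) ∂(F : Measure ℝ)
      ≤ ENNReal.ofReal (η / (8 * T ^ 2)) :=
    (le_iSup₂ (f := fun (H : ProbabilityMeasure ℝ) (_ : H ∈ 𝓗) =>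
      ∫⁻ x in {x : ℝ | K < |x|}, ENNReal.ofReal (x ^ 2) ∂(H : Measure ℝ)) F hF).trans hK.le
  set σ := LinearRandomField.sigma P ξ a Γ with hσdef
  set ρ := LinearRandomField.rho P ξ a Γ with hρdef
  have hX := (LinearRandomField.hasSum_S h (hmean F hF) (hvar F hF) a Γ).const_smul σ⁻¹
  simp_rw [smul_smul] at hX
  have hX1 : ‖σ⁻¹ • LinearRandomField.S P ξ a Γ‖ = 1 := by
    rw [norm_smul, ← LinearRandomField.sigma_eq_norm, ← hσdef, norm_inv,
      Real.norm_of_nonneg hσ.le, inv_mul_cancel₀ hσ.ne']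
  have hc (i : ℤ × ℤ) : |σ⁻¹ * LinearRandomField.b a Γ (-i)| ≤ ρ := by
    rw [abs_mul, abs_of_pos (inv_pos.2 hσ), ← div_eq_inv_mul]
    exact LinearRandomField.abs_b_div_sigma_le_rho a Γ (-i)
  have hρ0 : 0 ≤ ρ := (abs_nonneg _).trans (hc 0)
  have hρ1 : T * ρ ≤ 1 := by
    rw [mul_comm, ← le_div_iff₀ hT]; exact hρ.trans (min_le_left _ _)
  have hρ2 : ρ * (2 * T ^ 3 * (4 * K + 1)) ≤ η := by
    rw [← le_div_iff₀ (by positivity)]; exact hρ.trans (min_le_right _ _)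
  have hm := (Lp.aestronglyMeasurable (σ⁻¹ • LinearRandomField.S P ξ a Γ)).aemeasurable
  refine ciSup_le fun z => ?_
  rw [LinearRandomField.G_eq_cdf, LinearRandomField.Phi]
  refine hclose ⟨P.map (σ⁻¹ • LinearRandomField.S P ξ a Γ : Lp ℝ 2 P),
    Measure.isProbabilityMeasure_map hm⟩ (fun t ht => ?_) z
  have hb := h.norm_charFun_map_sub_exp_le (hmean F hF) (hvar F hF) hK0 hτ.le htail hX hX1 hc
    ((mul_le_mul_of_nonneg_right ht hρ0).trans hρ1)
  have hg : charFun (gaussianReal 0 1) t = (Real.exp (-(t ^ 2 / 2)) : ℂ) := by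
    rw [charFun_gaussianReal]; push_cast; congr 1; simp
  change ‖charFun (P.map _) t - charFun (gaussianReal 0 1) t‖ ≤ η
  rw [hg]
  refine hb.trans ?_
  calc t ^ 2 * (|t| * ρ * (4 * K + 1) + 4 * (η / (8 * T ^ 2)))
      ≤ T ^ 2 * (T * ρ * (4 * K + 1) + 4 * (η / (8 * T ^ 2))) := by
        rw [← sq_abs t]; gcongr
    _ = ρ * (2 * T ^ 3 * (4 * K + 1)) / 2 + η / 2 := by field_simp; ring
    _ ≤ η := by linarith
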